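/- Let $\Theta\subset\mathbb R^{D}$, and consider $N$ sensors. There are $P$ statistical models: for $p=1,\dots,P$ a family of probability measures $\{\hat{\mathscr P}_p^{\theta}:\theta\in\Theta\}$ on a measurable space $\hat{\mathscr X}_p$. The sensors $1,\dots,N$ are divided into disjoint groups $\mathcal G_1,\dots,\mathcal G_P$, and each $\mathcal G_p$ into $M_p$ disjoint nonempty subgroups $\mathcal G_p^{(1)},\dots,\mathcal G_p^{(M_p)}$. The sensors $j\in\mathcal G_p$ observe $\mathbf x_j$ with law $\hat{\mathscr P}_p^\theta$, and $\mathbf x_1,\dots,\mathbf x_N$ are independent. All the sensors of $\mathcal G_p^{(m)}$ use the same superquantizer $\hat\Gamma_p^{(m)}$, that is, an ordered list of $L_p^{(m)}$ vector quantizers, of which the $l$-th maps the $l$-th subvector of the observation to one of $\hat R_{pl}^{(m)}\ge 1$ levels according to an arbitrary partition of its domain into $\hat R_{pl}^{(m)}$ labelled quantization regions, and which as a function of the observation is measurable. For a sensor $j\in\mathcal G_p^{(m)}$ put $\Gamma_j=\hat\Gamma_p^{(m)}$, $L_j=L_p^{(m)}$, $R_{jl}=\hat R_{pl}^{(m)}$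 and, for each of the $\prod_l R_{jl}$ outcomes $\mathbf s$ of $\Gamma_j$, $q_j^{(\mathbf s)}(\theta)=\hat{\mathscr P}_p^\theta(\Gamma_j(\mathbf x_j)=\mathbf s)$. Let $\mathbf u=(\Gamma_1(\mathbf x_1),\dots,\Gamma_N(\mathbf x_N))$ be the quantized data. Define $$\lambda=\sum_{j=1}^N\prod_{l=1}^{L_j}R_{jl}-N,\qquad \lambda_{\mathrm{ISM}}=\sum_{p=1}^P\sum_{m=1}^{M_p}\Big(\prod_{l=1}^{L_p^{(m)}}\hat R_{pl}^{(m)}-1\Big).$$ The Fisher information matrix (FIM) at $\theta$ is $$\mathbf J(\theta)=\sum_{j=1}^N\sum_{\mathbf s}\frac{1}{q_j^{(\mathbf s)}(\theta)}\frac{\partial q_j^{(\mathbf s)}(\theta)}{\partial\theta}\Big[\frac{\partial q_j^{(\mathbf s)}(\theta)}{\partial\theta}\Big]^T,$$ where the terms with $q_j^{(\mathbf s)}(\theta)=0$ are left out. Derivatives are taken along $\Theta$ (they are the usual ones in the interior). Call $\theta\in\Theta$ nondegenerate if the tangent directions of $\Theta$ at $\theta$ span $\mathbb R^D$, so that derivatives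 along $\Theta$ are unique at $\theta$; all interior points are nondegenerate. A point $\theta\in\Theta$ is identifiable if no $\theta'\in\Theta\setminus\{\theta\}$ satisfies $\Pr(\mathbf u=\mathbf a\mid\theta)=\Pr(\mathbf u=\mathbf a\mid\theta')$ for all possible values $\mathbf a$ of $\mathbf u$, and $\Theta$ is identifiable if all its points are. Then $\lambda_{\mathrm{ISM}}\le\lambda$. Suppose moreover that $\Theta$ has nonempty interior and that $D>\lambda_{\mathrm{ISM}}$. (a) If every $q_j^{(\mathbf s)}$ is twice differentiable on $\Theta$, then $\mathbf J(\theta)$ is singular for every nondegenerate $\theta\in\Theta$. Furthermore, the matrix $\big(-\mathbb E_\theta\,\partial^2\ln\Pr(\mathbf u\mid\theta)/\partial\theta_l\partial\theta_m\big)_{l,m}$ is singular at every $\theta\in\Theta$ such that all points of $\Theta$ near $\theta$ are nondegenerate and each $q_j^{(\mathbf s)}$ is either nonzero at $\theta$ or zero at all points of $\Theta$ near $\theta$. (b) If every $q_j^{(\mathbf s)}$ is continuous on $\Theta$, then $\Theta$ is not identifiable, and every nonempty set $U\subset\Theta$ that is open in $\mathbb R^D$ contains infinitely many points that are not identifiable.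 -/

import Mathlib

open Topology

universe u v

noncomputable section

/-- A superquantizer on an observation space `X`: an ordered list of `L` vector quantizers.
The `l`-th one sees the subvector `sub l x` of the observation `x` and returns one of `R l` levels.
Its quantization regions are the fibres of `γ l`; they are disjoint and cover its domain. -/
structure Superquantizer (X : Type u) [MeasurableSpace X] where
  /-- number of vector quantizers -/
  L : ℕ
  /-- numbers of quantization levels -/
  R : Fin L → ℕ
  R_pos : ∀ l, 0 < R l
  /-- the spaces in which the subvectors live -/
  Sub : Fin L → Type v
  /-- the subvectors of an observation -/
  sub : ∀ l, X → Sub l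
  /-- the vector quantizers -/
  γ : ∀ l, Sub l → Fin (R l)
  measurable_level : ∀ l, Measurable fun x => γ l (sub l x)

namespace Superquantizer

variable {X : Type u} [MeasurableSpace X]

/-- The outcomes of a superquantizer: one level for each of its vector quantizers. -/
abbrev Outcome (Γ : Superquantizer.{u, v} X) : Type := ∀ l, Fin (Γ.R l)

/-- The superquantized vector of an observation. -/
def output (Γ : Superquantizer.{u, v} X) (x : X) : Γ.Outcome := fun l => Γ.γ l (Γ.sub l x)

/-- The number of outcomes, the product of the numbers of levels. -/
def numOutcomes (Γ : Superquantizer.{u, v} X) : ℕ := ∏ l, Γ.R l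

end Superquantizer

/-- A real function is twice differentiable on `s`. Derivatives are taken along `s`, so this is the
usual notion in the interior of `s` and a one-sided one on its boundary. -/
def TwiceDifferentiableOn {D : ℕ} (f : EuclideanSpace ℝ (Fin D) → ℝ)
    (s : Set (EuclideanSpace ℝ (Fin D))) : Prop :=
  ∃ f' : EuclideanSpace ℝ (Fin D) → EuclideanSpace ℝ (Fin D) →L[ℝ] ℝ,
    (∀ x ∈ s, HasFDerivWithinAt f (f' x) s x) ∧ DifferentiableOn ℝ f' s

/-- The partial derivative of `f` at `x` in the `l`-th coordinate, taken along `s`. -/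
def partialDerivWithin {D : ℕ} (s : Set (EuclideanSpace ℝ (Fin D)))
    (f : EuclideanSpace ℝ (Fin D) → ℝ) (l : Fin D) (x : EuclideanSpace ℝ (Fin D)) : ℝ :=
  fderivWithin ℝ f s x (EuclideanSpace.single l 1)

/-- A quantized estimation system with `N` sensors and a `D`-dimensional parameter. Only the values
of `law` at parameters in `Θ` matter. -/
structure SensorSystem (D : ℕ) where
  /-- the parameter space -/
  Θ : Set (EuclideanSpace ℝ (Fin D))
  /-- number of sensors -/
  N : ℕ
  /-- observation spaces -/
  X : Fin N → Type u
  mX : ∀ j, MeasurableSpace (X j)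
  /-- laws of the observations -/
  law : ∀ j, EuclideanSpace ℝ (Fin D) → MeasureTheory.Measure (X j)
  law_prob : ∀ j, ∀ θ ∈ Θ, MeasureTheory.IsProbabilityMeasure (law j θ)
  /-- superquantizers -/
  Γ : ∀ j, Superquantizer.{u, v} (X j)

attribute [instance] SensorSystem.mX

namespace SensorSystem

variable {D : ℕ} (S : SensorSystem.{u, v} D)

/-- The probability that sensor `j` produces the outcome `s`. -/
def q (j : Fin S.N) (s : (S.Γ j).Outcome) (θ : EuclideanSpace ℝ (Fin D)) : ℝ :=
  (S.law j θ).real {x | (S.Γ j).output x = s}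

/-- The possible values of the whole quantized data. -/
abbrev Data : Type := ∀ j, (S.Γ j).Outcome

/-- The probability of the quantized data `w`; the observations at different sensors are
independent. -/
def prob (w : S.Data) (θ : EuclideanSpace ℝ (Fin D)) : ℝ :=
  (MeasureTheory.Measure.pi fun j => S.law j θ).real {x | ∀ j, (S.Γ j).output (x j) = w j}

/-- The log-likelihood function of the quantized data `w`. -/
def logLik (w : S.Data) (θ : EuclideanSpace ℝ (Fin D)) : ℝ := Real.log (S.prob w θ)

/-- The Fisher information matrix of the quantized data. Outcomes of probability zero are left out
(in Lean the inverse of zero is zero). -/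
def fisher (θ : EuclideanSpace ℝ (Fin D)) : Matrix (Fin D) (Fin D) ℝ :=
  ∑ j, ∑ s : (S.Γ j).Outcome, (S.q j s θ)⁻¹ •
    Matrix.vecMulVec (fun l => partialDerivWithin S.Θ (S.q j s) l θ)
      (fun l => partialDerivWithin S.Θ (S.q j s) l θ)

/-- The Fisher information matrix as minus the expected matrix of second partial derivatives of
the log-likelihood function. -/
def hessianFisher (θ : EuclideanSpace ℝ (Fin D)) : Matrix (Fin D) (Fin D) ℝ :=
  Matrix.of fun l m => -∑ w : S.Data, S.prob w θ *
    partialDerivWithin S.Θ (partialDerivWithin S.Θ (S.logLik w) m) l θ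

/-- Two distinct parameter points under which the quantized data have the same distribution. -/
def ObsEquiv (θ θ' : EuclideanSpace ℝ (Fin D)) : Prop :=
  θ ∈ S.Θ ∧ θ' ∈ S.Θ ∧ θ ≠ θ' ∧ ∀ w : S.Data, S.prob w θ = S.prob w θ'

/-- A parameter point that is observationally equivalent to no other one. -/
def IdentifiableAt (θ : EuclideanSpace ℝ (Fin D)) : Prop :=
  ¬ ∃ θ', S.ObsEquiv θ θ'

/-- All points of the parameter space are identifiable. -/
def IsIdentifiable : Prop := ∀ θ ∈ S.Θ, S.IdentifiableAt θ

/-- The inestimable dimension for quantized data. -/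
def IDQD : ℤ := (∑ j, ((S.Γ j).numOutcomes : ℤ)) - S.N

end SensorSystem

/-- A quantized estimation system in which sensors share statistical models and superquantizers:
there are `P` models, `M p` superquantizers used with the `p`-th model, and the sensor `j`, with
`group j = ⟨p, m⟩`, has the `p`-th model and the `m`-th superquantizer belonging to it. The
subgroups, the fibres of `group`, are nonempty. -/
structure GroupedSystem (D : ℕ) where
  /-- the parameter space -/
  Θ : Set (EuclideanSpace ℝ (Fin D))
  /-- number of sensors -/
  N : ℕ
  /-- number of statistical models -/
  P : ℕ
  /-- observation spaces of the models -/
  X : Fin P → Type u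
  mX : ∀ p, MeasurableSpace (X p)
  /-- laws of the models -/
  law : ∀ p, EuclideanSpace ℝ (Fin D) → MeasureTheory.Measure (X p)
  law_prob : ∀ p, ∀ θ ∈ Θ, MeasureTheory.IsProbabilityMeasure (law p θ)
  /-- numbers of subgroups -/
  M : Fin P → ℕ
  /-- superquantizers of the subgroups -/
  Γ : ∀ p, Fin (M p) → Superquantizer.{u, v} (X p)
  /-- the subgroup of a sensor -/
  group : Fin N → Σ p, Fin (M p)
  group_surjective : Function.Surjective group

attribute [instance] GroupedSystem.mX

namespace GroupedSystem

variable {D : ℕ} (G : GroupedSystem.{u, v} D)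

/-- The underlying system of sensors. -/
def toSensorSystem : SensorSystem.{u, v} D where
  Θ := G.Θ
  N := G.N
  X j := G.X (G.group j).1
  mX j := G.mX (G.group j).1
  law j := G.law (G.group j).1
  law_prob j := G.law_prob (G.group j).1
  Γ j := G.Γ (G.group j).1 (G.group j).2

/-- The refined inestimable dimension for quantized data. -/
def rIDQD : ℤ := ∑ p, ∑ m : Fin (G.M p), (((G.Γ p m).numOutcomes : ℤ) - 1)

end GroupedSystem

end

/-!
In each subgroup the outcome probabilities sum to one, so all but one of them determine the rest.
Over all subgroups this leaves exactly `rIDQD` free outcome probabilities (`card_freeCell`), and the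
law of the quantized data depends on the parameter only through this map from `ℝ^D` to a space of
dimension `rIDQD < D`.

For the Fisher information matrix this is linear algebra: some direction `c ≠ 0` is annihilated by
the differentials of the free probabilities, hence by those of all the outcome probabilities and of
all the probabilities of the whole data (`exists_ne_zero_fderivWithin_q_eq_zero`). The Fisher matrix
is built from these differentials, so it kills `c`. In the expected Hessian of the log-likelihood,
contracting with `c` removes the terms quadratic in the differentials, and what remains is a second
derivative of the total probability, which is constant
(`det_expected_hessian_log_eq_zero`).

For identifiability one needs that a continuous map on a nonempty open set of `ℝ^D` into a space of
smaller dimension is not injective (`not_injOn_of_finrank_lt`). An injective one could be restricted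
to a closed ball, where it has a continuous left inverse that extends to the whole target. Smooth
approximations of the two maps compose to a map close to the identity on the ball whose Jacobian
determinant vanishes everywhere. Such a map does not exist
(`exists_lt_norm_sub_of_det_fderiv_eq_zero`), by a degree argument. Interpolate it with the identity
near the sphere, and call the result `id + v`. For small `t` the map `id + t v` is a diffeomorphism
of the ball, so the change of variables formula evaluates the integral of
`ρ (x + t v x) ^ n * det (1 + t v' x)` as that of `ρ ^ n`, where `ρ y = 1 - ‖y‖² / 4`. Both sides
are polynomial in `t`, so they agree at `t = 1` too (`setIntegral_weight_mul_det`). There the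
determinant vanishes on the inner half of the ball, while the outer half is mapped away from the
origin, where `ρ` is largest; for large `n` this is a contradiction.
-/

/-! ### A polynomial identity in the perturbation parameter -/

section Degree

open MeasureTheory Metric

/-- If `F t x` is polynomial in `t` of bounded degree, and its integral over `x` does not depend on
`t` for small positive `t`, then it does not depend on `t` at all. -/
theorem integral_eq_of_polynomial_of_small {X : Type*} [MeasurableSpace X] {μ : Measure X}
    {F : ℝ → X → ℝ} {n : ℕ}
    (hF : ∀ x, ∃ p : Polynomial ℝ, p.natDegree ≤ n ∧ ∀ t, F t x = p.eval t)
    (hint : ∀ t, Integrable (F t) μ) {c δ : ℝ} (hδ : 0 < δ)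
    (hc : ∀ t, 0 < t → t < δ → ∫ x, F t x ∂μ = c) (t : ℝ) :
    ∫ x, F t x ∂μ = c := by
  -- Interpolate at `n + 1` nodes inside `(0, δ)`.
  let node : ℕ → ℝ := fun i => δ / (i + 2)
  have hnode : Set.InjOn node (Finset.range (n + 1)) := by
    intro i _ j _ hij
    have : (i : ℝ) + 2 = j + 2 := by
      have h := congrArg (fun y => δ / y) hij
      simpa [node, div_div_cancel₀ hδ.ne'] using h
    exact_mod_cast add_right_cancel this
  let w : ℕ → ℝ := fun i => (Lagrange.basis (Finset.range (n + 1)) node i).eval t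
  have hw : ∑ i ∈ Finset.range (n + 1), w i = 1 := by
    have h := congrArg (Polynomial.eval t) (Lagrange.sum_basis hnode ⟨0, by simp⟩)
    simpa [Polynomial.eval_finsetSum] using h
  have hFt : F t = fun x => ∑ i ∈ Finset.range (n + 1), F (node i) x * w i := by
    funext x
    obtain ⟨p, hp, hpF⟩ := hF x
    have hdeg : p.degree < (Finset.range (n + 1)).card := by
      rw [Finset.card_range]
      exact lt_of_le_of_lt Polynomial.degree_le_natDegree (by exact_mod_cast Nat.lt_succ_of_le hp)
    have h := congrArg (Polynomial.eval t) (Lagrange.eq_interpolate hnode hdeg)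
    simpa [Lagrange.interpolate_apply, Polynomial.eval_finsetSum, hpF, w] using h
  rw [hFt, integral_finsetSum _ fun i _ => (hint _).mul_const _]
  simp_rw [integral_mul_const]
  have : ∀ i ∈ Finset.range (n + 1), (∫ x, F (node i) x ∂μ) * w i = c * w i := by
    intro i _
    have hi : (0 : ℝ) < i + 2 := by positivity
    rw [hc (node i) (by positivity)]
    rw [div_lt_iff₀ hi]
    nlinarith [(Nat.cast_nonneg i : (0 : ℝ) ≤ i)]
  rw [Finset.sum_congr rfl this, ← Finset.mul_sum, hw, mul_one]

theorem exists_polynomial_eval_eq_det {E : Type*} [NormedAddCommGroup E] [NormedSpace ℝ E]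
    [FiniteDimensional ℝ E] (A : E →L[ℝ] E) :
    ∃ p : Polynomial ℝ, p.natDegree ≤ Module.finrank ℝ E ∧
      ∀ t : ℝ, (ContinuousLinearMap.id ℝ E + t • A).det = p.eval t := by
  let b := Module.finBasis ℝ E
  let M := LinearMap.toMatrix b b (A : E →ₗ[ℝ] E)
  refine ⟨_, (Polynomial.natDegree_det_X_add_C_le M 1).trans_eq (Fintype.card_fin _), fun t => ?_⟩
  rw [← Polynomial.coe_evalRingHom, RingHom.map_det, ContinuousLinearMap.det,
    ← LinearMap.det_toMatrix b]
  congr 1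
  ext i j
  simp [M, LinearMap.toMatrix_apply, Matrix.one_apply, Module.Basis.repr_self,
    Finsupp.single_apply, eq_comm, add_comm, mul_comm t, apply_ite]

theorem exists_polynomial_eval_eq_weight {E : Type*} [NormedAddCommGroup E]
    [InnerProductSpace ℝ E] (x v : E) (n : ℕ) :
    ∃ p : Polynomial ℝ, p.natDegree ≤ n * 2 ∧
      ∀ t : ℝ, (1 - ‖x + t • v‖ ^ 2 / 4) ^ n = p.eval t := by
  refine ⟨(Polynomial.C (-‖v‖ ^ 2 / 4) * Polynomial.X ^ 2 +
    Polynomial.C (-(inner ℝ x v) / 2) * Polynomial.X + Polynomial.C (1 - ‖x‖ ^ 2 / 4)) ^ n,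
    Polynomial.natDegree_pow_le_of_le n Polynomial.natDegree_quadratic_le, fun t => ?_⟩
  simp only [Polynomial.eval_pow, Polynomial.eval_add, Polynomial.eval_mul, Polynomial.eval_C,
    Polynomial.eval_X]
  rw [norm_add_sq_real, norm_smul, mul_pow, inner_smul_right, Real.norm_eq_abs, sq_abs]
  ring

/-! ### Perturbations of the identity -/

/-- Small perturbations of the identity by a `C¹` vector field that vanishes outside the unit ball
are orientation-preserving bijections of the closed unit ball. -/
theorem exists_forall_small_perturbation {E : Type*} [NormedAddCommGroup E] [NormedSpace ℝ E]
    [FiniteDimensional ℝ E] {v : E → E} (hv : ContDiff ℝ 1 v) (hv0 : ∀ x, 1 ≤ ‖x‖ → v x = 0) :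
    ∃ δ : ℝ, 0 < δ ∧ ∀ t, 0 < t → t < δ →
      Function.Injective (fun x => x + t • v x) ∧
      (fun x => x + t • v x) '' closedBall 0 1 = closedBall 0 1 ∧
      ∀ x, 0 < (ContinuousLinearMap.id ℝ E + t • fderiv ℝ v x).det := by
  have hsupp : HasCompactSupport v :=
    HasCompactSupport.intro (isCompact_closedBall (0 : E) 1) fun x hx => hv0 x (by
      simp only [mem_closedBall, dist_zero_right, not_le] at hx
      exact hx.le)
  obtain ⟨C, hC⟩ := ContDiff.lipschitzWith_of_hasCompactSupport hsupp hv one_ne_zero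
  have hdet : ∀ᶠ A in 𝓝 (ContinuousLinearMap.id ℝ E), 0 < A.det :=
    ContinuousLinearMap.continuous_det.continuousAt.eventually
      (lt_mem_nhds (by simp [ContinuousLinearMap.det]))
  obtain ⟨ε, hε, hεdet⟩ := Metric.eventually_nhds_iff.1 hdet
  have hC1 : (0 : ℝ) < C + 1 := by positivity
  refine ⟨min 1 ε / (C + 1), by positivity, fun t ht htδ => ?_⟩
  rw [lt_div_iff₀ hC1] at htδ
  have htC : t * C < min 1 ε := by nlinarith
  have hlip : ∀ x y, ‖t • v x - t • v y‖ ≤ t * C * ‖x - y‖ := by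
    intro x y
    rw [← smul_sub, norm_smul, Real.norm_of_nonneg ht.le, mul_assoc]
    gcongr
    simpa [dist_eq_norm] using hC.dist_le_mul x y
  have hinj : Function.Injective (fun x => x + t • v x) := by
    intro x y hxy
    have h1 : x - y = -(t • v x - t • v y) := by
      have : x + t • v x = y + t • v y := hxy
      rw [neg_sub, sub_eq_sub_iff_add_eq_add, this, add_comm]
    have h2 := hlip x y
    rw [← norm_neg (t • v x - t • v y), ← h1] at h2
    have h3 : t * C < 1 := htC.trans_le (min_le_left _ _)
    have h4 : ‖x - y‖ ≤ 0 := by nlinarith [norm_nonneg (x - y)]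
    exact sub_eq_zero.1 (norm_le_zero_iff.1 h4)
  have hsurj : Function.Surjective (fun x => x + t • v x) := by
    intro y
    have hK : ContractingWith (t.toNNReal * C) (fun x => y - t • v x) := by
      refine ⟨?_, LipschitzWith.of_dist_le_mul fun x z => ?_⟩
      · rw [← NNReal.coe_lt_coe]
        simpa [Real.coe_toNNReal _ ht.le] using htC.trans_le (min_le_left _ _)
      · rw [dist_sub_left, dist_eq_norm, dist_eq_norm]
        simpa [Real.coe_toNNReal _ ht.le] using hlip x z
    refine ⟨hK.fixedPoint, ?_⟩
    have h : y - t • v hK.fixedPoint = hK.fixedPoint := hK.fixedPoint_isFixedPt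
    exact (sub_eq_iff_eq_add.1 h).symm
  have hout : ∀ x, x ∉ closedBall (0 : E) 1 → x + t • v x = x := by
    intro x hx
    simp only [mem_closedBall, dist_zero_right, not_le] at hx
    simp [hv0 x hx.le]
  refine ⟨hinj, Set.Subset.antisymm ?_ ?_, fun x => hεdet ?_⟩
  · rintro _ ⟨x, hx, rfl⟩
    by_contra h
    exact h ((hinj (hout _ h)).symm ▸ hx)
  · intro y hy
    obtain ⟨x, rfl⟩ := hsurj y
    refine ⟨x, ?_, rfl⟩
    by_contra h
    have := hout x h
    simp only [this] at hy
    exact h hy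
  · rw [dist_eq_norm, add_sub_cancel_left, norm_smul, Real.norm_of_nonneg ht.le]
    calc t * ‖fderiv ℝ v x‖ ≤ t * C := by
          gcongr
          exact norm_fderiv_le_of_lipschitz ℝ hC
      _ < ε := htC.trans_le (min_le_right _ _)

variable {E : Type*} [NormedAddCommGroup E] [InnerProductSpace ℝ E] [FiniteDimensional ℝ E]
  [MeasurableSpace E] [BorelSpace E]

/-- The degree of a map of the closed unit ball that is the identity near the boundary is one, in
integrated form with the weight `(1 - ‖y‖² / 4) ^ n`. -/
theorem setIntegral_weight_mul_det {v : E → E} (hv : ContDiff ℝ 1 v)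
    (hv0 : ∀ x, 1 ≤ ‖x‖ → v x = 0) (n : ℕ) :
    ∫ x in closedBall (0 : E) 1,
      (1 - ‖x + v x‖ ^ 2 / 4) ^ n * (ContinuousLinearMap.id ℝ E + fderiv ℝ v x).det =
    ∫ x in closedBall (0 : E) 1, (1 - ‖x‖ ^ 2 / 4) ^ n := by
  obtain ⟨δ, hδ, h⟩ := exists_forall_small_perturbation hv hv0
  have hdv : Continuous (fderiv ℝ v) := hv.continuous_fderiv one_ne_zero
  have hvc := hv.continuous
  have key := integral_eq_of_polynomial_of_small
    (μ := volume.restrict (closedBall (0 : E) 1))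
    (F := fun t x => (1 - ‖x + t • v x‖ ^ 2 / 4) ^ n *
      (ContinuousLinearMap.id ℝ E + t • fderiv ℝ v x).det)
    (n := n * 2 + Module.finrank ℝ E)
    (c := ∫ x in closedBall (0 : E) 1, (1 - ‖x‖ ^ 2 / 4) ^ n) ?_ ?_ hδ ?_ 1
  · simpa only [one_smul] using key
  · intro x
    obtain ⟨p, hp, hpe⟩ := exists_polynomial_eval_eq_weight x (v x) n
    obtain ⟨r, hr, hre⟩ := exists_polynomial_eval_eq_det (fderiv ℝ v x)
    refine ⟨p * r, Polynomial.natDegree_mul_le.trans (add_le_add hp hr), fun t => ?_⟩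
    rw [Polynomial.eval_mul, hpe, hre]
  · intro t
    refine ContinuousOn.integrableOn_compact (isCompact_closedBall 0 1) (Continuous.continuousOn ?_)
    refine Continuous.mul (by fun_prop) (ContinuousLinearMap.continuous_det.comp (by fun_prop))
  · intro t ht htδ
    obtain ⟨hinj, himg, hdet⟩ := h t ht htδ
    have hd : ∀ x ∈ closedBall (0 : E) 1, HasFDerivWithinAt (fun x => x + t • v x)
        (ContinuousLinearMap.id ℝ E + t • fderiv ℝ v x) (closedBall 0 1) x := fun x _ =>
      ((hasFDerivAt_id x).add
        (((hv.differentiable one_ne_zero) x).hasFDerivAt.const_smul t)).hasFDerivWithinAt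
    have hcv := integral_image_eq_integral_abs_det_fderiv_smul volume measurableSet_closedBall hd
      hinj.injOn (fun y => (1 - ‖y‖ ^ 2 / 4) ^ n)
    rw [himg] at hcv
    rw [hcv]
    refine integral_congr_ae (Filter.Eventually.of_forall fun x => ?_)
    simp only [abs_of_pos (hdet x), smul_eq_mul, mul_comm]

/-- A `C¹` map that is close to the identity on the unit ball cannot be degenerate everywhere. -/
theorem exists_lt_norm_sub_of_det_fderiv_eq_zero {φ : E → E} (hφ : ContDiff ℝ 1 φ)
    (hdet : ∀ x, (fderiv ℝ φ x).det = 0) : ∃ x ∈ closedBall (0 : E) 1, 1 / 8 < ‖φ x - x‖ := by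
  by_contra! hclose
  -- Deform `φ` to the identity near the unit sphere, keeping it unchanged on half the ball.
  let χ : ContDiffBump (0 : E) := ⟨1 / 2, 1, by norm_num, by norm_num⟩
  let v : E → E := fun x => χ x • (φ x - x)
  have hv : ContDiff ℝ 1 v := χ.contDiff.smul (hφ.sub contDiff_id)
  have hv0 : ∀ x, 1 ≤ ‖x‖ → v x = 0 := by
    intro x hx
    have : χ x = 0 := χ.zero_of_le_dist (by simpa using hx)
    simp [v, this]
  have hvle : ∀ x ∈ closedBall (0 : E) 1, ‖v x‖ ≤ 1 / 8 := by
    intro x hx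
    rw [norm_smul, Real.norm_of_nonneg χ.nonneg]
    calc χ x * ‖φ x - x‖ ≤ 1 * (1 / 8) := by
          gcongr
          · exact χ.le_one
          · exact hclose x hx
      _ = 1 / 8 := one_mul _
  have hdet0 : ∀ x, ‖x‖ < 1 / 2 → (ContinuousLinearMap.id ℝ E + fderiv ℝ v x).det = 0 := by
    intro x hx
    have hev : (fun y => y + v y) =ᶠ[𝓝 x] φ := by
      filter_upwards [isOpen_ball.mem_nhds (show x ∈ ball (0 : E) (1 / 2) by simpa using hx)]
        with y hy
      have : χ y = 1 := χ.one_of_mem_closedBall (ball_subset_closedBall hy)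
      simp [v, this]
    have h1 : HasFDerivAt (fun y => y + v y) (ContinuousLinearMap.id ℝ E + fderiv ℝ v x) x :=
      (hasFDerivAt_id x).add ((hv.differentiable one_ne_zero) x).hasFDerivAt
    rw [← h1.fderiv, hev.fderiv_eq, hdet]
  have hcont : Continuous fun x => (ContinuousLinearMap.id ℝ E + fderiv ℝ v x).det :=
    ContinuousLinearMap.continuous_det.comp
      (continuous_const.add (hv.continuous_fderiv one_ne_zero))
  obtain ⟨C, hC⟩ := (isCompact_closedBall (0 : E) 1).exists_bound_of_continuousOn hcont.continuousOn
  set V := volume.real (closedBall (0 : E) 1)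
  set W := volume.real (closedBall (0 : E) (1 / 4))
  have hW : 0 < W := ENNReal.toReal_pos
    (measure_closedBall_pos _ _ (by norm_num)).ne' measure_closedBall_lt_top.ne
  -- Where the determinant is nonzero, the deformed map stays away from the origin.
  have hupper : ∀ n : ℕ, ∫ x in closedBall (0 : E) 1, (1 - ‖x‖ ^ 2 / 4) ^ n ≤
      (247 / 256) ^ n * C * V := by
    intro n
    rw [← setIntegral_weight_mul_det hv hv0 n]
    refine (Real.le_norm_self _).trans (norm_setIntegral_le_of_norm_le_const
      (C := (247 / 256) ^ n * C) measure_closedBall_lt_top fun x hx => ?_)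
    rw [norm_mul]
    rcases lt_or_ge ‖x‖ (1 / 2) with h | h
    · rw [hdet0 x h, norm_zero, mul_zero]
      have := (norm_nonneg _).trans (hC x hx)
      positivity
    · have hx1 : ‖x‖ ≤ 1 := by simpa using hx
      have h1 : 3 / 8 ≤ ‖x + v x‖ := by
        have := norm_sub_le_norm_add x (v x)
        linarith [hvle x hx]
      have h2 : ‖x + v x‖ ≤ 9 / 8 := by linarith [norm_add_le x (v x), hvle x hx]
      have h3 : ‖1 - ‖x + v x‖ ^ 2 / 4‖ ≤ 247 / 256 := by
        rw [Real.norm_eq_abs, abs_le]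
        constructor <;> nlinarith
      rw [norm_pow]
      gcongr
      exact hC x hx
  have hlower : ∀ n : ℕ, (252 / 256 : ℝ) ^ n * W ≤
      ∫ x in closedBall (0 : E) 1, (1 - ‖x‖ ^ 2 / 4) ^ n := by
    intro n
    have hint : IntegrableOn (fun x : E => (1 - ‖x‖ ^ 2 / 4) ^ n) (closedBall 0 1) :=
      ContinuousOn.integrableOn_compact (isCompact_closedBall 0 1)
        (Continuous.continuousOn (by fun_prop))
    have hsub : closedBall (0 : E) (1 / 4) ⊆ closedBall 0 1 :=
      closedBall_subset_closedBall (by norm_num)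
    calc (252 / 256 : ℝ) ^ n * W ≤ ∫ x in closedBall (0 : E) (1 / 4), (1 - ‖x‖ ^ 2 / 4) ^ n := by
          refine setIntegral_ge_of_const_le_real measurableSet_closedBall
            measure_closedBall_lt_top.ne (fun x hx => ?_) (hint.mono_set hsub)
          have : ‖x‖ ≤ 1 / 4 := by simpa using hx
          gcongr
          nlinarith [norm_nonneg x]
      _ ≤ _ := by
          refine setIntegral_mono_set hint ?_ (Filter.Eventually.of_forall hsub)
          refine ae_restrict_of_forall_mem measurableSet_closedBall fun x hx => ?_
          have : ‖x‖ ≤ 1 := by simpa using hx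
          refine pow_nonneg ?_ n
          nlinarith [norm_nonneg x]
  -- The lower bound `(252 / 256) ^ n * W` outgrows the upper bound `(247 / 256) ^ n * C * V`.
  have hlim : Filter.Tendsto (fun n : ℕ => (247 / 252 : ℝ) ^ n * (C * V)) Filter.atTop (𝓝 0) := by
    simpa using (tendsto_pow_atTop_nhds_zero_of_lt_one (by norm_num)
      (by norm_num : (247 / 252 : ℝ) < 1)).mul_const (C * V)
  obtain ⟨n, hn⟩ := (hlim.eventually (gt_mem_nhds hW)).exists
  have hpow : (247 / 256 : ℝ) ^ n = (252 / 256) ^ n * (247 / 252) ^ n := by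
    rw [← mul_pow]; norm_num
  have h1 := (hlower n).trans (hupper n)
  rw [hpow] at h1
  have h2 : (0 : ℝ) < (252 / 256) ^ n := by positivity
  nlinarith

end Degree

/-! ### No continuous injection into a space of smaller dimension -/

section SmallerDimension

open Metric

/-- A continuous injection of the unit ball into a space of smaller dimension would have a
continuous left inverse. Smooth approximations of both maps compose to a map that is close to the
identity but factors through the smaller space, so that its Jacobian determinant vanishes. -/
theorem not_injOn_closedBall_of_finrank_lt {E F : Type*} [NormedAddCommGroup E] [InnerProductSpace ℝ E]
    [FiniteDimensional ℝ E] [NormedAddCommGroup F] [NormedSpace ℝ F] [FiniteDimensional ℝ F]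
    (hEF : Module.finrank ℝ F < Module.finrank ℝ E) {f : E → F}
    (hf : ContinuousOn f (closedBall 0 1)) : ¬ Set.InjOn f (closedBall 0 1) := by
  intro hinj
  borelize E
  have hcomp := isCompact_iff_compactSpace.1 (isCompact_closedBall (0 : E) 1)
  -- The compact ball embeds in `F`; extend the inverse and the map itself.
  let e : closedBall (0 : E) 1 → F := (closedBall (0 : E) 1).domRestrict f
  have he : IsClosedEmbedding e :=
    (continuousOn_iff_continuous_domRestrict.1 hf).isClosedEmbedding
      ((Set.injOn_iff_injective).1 hinj)
  obtain ⟨h, hh⟩ := ContinuousMap.exists_extension he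
    (⟨Subtype.val, continuous_subtype_val⟩ : C(closedBall (0 : E) 1, E))
  obtain ⟨k, hk⟩ := ContinuousMap.exists_extension
    (isClosed_closedBall (x := (0 : E)) (ε := 1)).isClosedEmbedding_subtypeVal
    (⟨e, he.continuous⟩ : C(closedBall (0 : E) 1, F))
  have hhk : ∀ x ∈ closedBall (0 : E) 1, h (k x) = x := by
    intro x hx
    have h1 : k x = e ⟨x, hx⟩ := DFunLike.congr_fun hk ⟨x, hx⟩
    rw [h1]
    exact DFunLike.congr_fun hh ⟨x, hx⟩
  obtain ⟨g, hg, hgh⟩ := h.continuous.exists_contDiff_approx 1 (ε := fun _ => 1 / 16)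
    continuous_const (fun _ => by norm_num)
  have hK := (isCompact_closedBall (0 : E) 1).image k.continuous
  have hunif := hK.uniformContinuousAt_of_continuousAt h (fun a _ => h.continuous.continuousAt)
    (Metric.dist_mem_uniformity (show (0 : ℝ) < 1 / 16 by norm_num))
  obtain ⟨δ, hδ, hδh⟩ := Metric.mem_uniformity_dist.1 hunif
  obtain ⟨m, hm, hmk⟩ := k.continuous.exists_contDiff_approx 1 (ε := fun _ => δ)
    continuous_const (fun _ => hδ)
  have hg' : ContDiff ℝ 1 g := hg
  have hm' : ContDiff ℝ 1 m := hm
  obtain ⟨x, hx, hlt⟩ := exists_lt_norm_sub_of_det_fderiv_eq_zero (φ := fun x => g (m x))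
    (hg'.comp hm') fun x => by
      have h1 : fderiv ℝ (fun x => g (m x)) x = (fderiv ℝ g (m x)).comp (fderiv ℝ m x) :=
        fderiv_comp x ((hg'.differentiable one_ne_zero) _) ((hm'.differentiable one_ne_zero) _)
      rw [h1]
      refine LinearMap.det_eq_zero_iff_ker_ne_bot.2 fun hbot => ?_
      refine LinearMap.ker_ne_bot_of_finrank_lt (f := (fderiv ℝ m x : E →ₗ[ℝ] F)) hEF
        (le_bot_iff.1 (le_trans ?_ hbot.le))
      intro y hy
      have hy' : fderiv ℝ m x y = 0 := hy
      simp [LinearMap.mem_ker, hy']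
  have h1 : dist (h (k x)) (h (m x)) < 1 / 16 :=
    hδh (show dist (k x) (m x) < δ by rw [dist_comm]; exact hmk.1 x) ⟨x, hx, rfl⟩
  have h2 : dist (g (m x)) (h (m x)) < 1 / 16 := hgh.1 (m x)
  rw [hhk x hx] at h1
  rw [← dist_eq_norm] at hlt
  linarith [dist_triangle_right (g (m x)) x (h (m x))]

/-- A map continuous on a nonempty open set is not injective there if the target has smaller
dimension. -/
theorem not_injOn_of_finrank_lt {E F : Type*} [NormedAddCommGroup E] [InnerProductSpace ℝ E]
    [FiniteDimensional ℝ E] [NormedAddCommGroup F] [NormedSpace ℝ F] [FiniteDimensional ℝ F]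
    (hEF : Module.finrank ℝ F < Module.finrank ℝ E) {f : E → F} {U : Set E}
    (hU : IsOpen U) (hne : U.Nonempty) (hf : ContinuousOn f U) : ¬ Set.InjOn f U := by
  intro hinj
  obtain ⟨a, ha⟩ := hne
  obtain ⟨r, hr, hball⟩ := Metric.nhds_basis_closedBall.mem_iff.1 (hU.mem_nhds ha)
  have hmaps : Set.MapsTo (fun x : E => a + r • x) (closedBall 0 1) U := by
    intro x hx
    refine hball ?_
    have : ‖x‖ ≤ 1 := by simpa using hx
    rw [mem_closedBall, dist_eq_norm, add_sub_cancel_left, norm_smul, Real.norm_of_nonneg hr.le]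
    exact mul_le_of_le_one_right hr.le this
  refine not_injOn_closedBall_of_finrank_lt hEF
    (f := fun x => f (a + r • x)) (hf.comp (by fun_prop) hmaps) ?_
  intro x hx y hy hxy
  have := add_left_cancel (hinj (hmaps hx) (hmaps hy) hxy)
  exact smul_right_injective E hr.ne' this

end SmallerDimension

/-! ### Derivatives along a set -/

section Calculus

variable {D : ℕ} {s : Set (EuclideanSpace ℝ (Fin D))} {θ : EuclideanSpace ℝ (Fin D)}

theorem sum_apply_single_mul (A : EuclideanSpace ℝ (Fin D) →L[ℝ] ℝ)
    (c : EuclideanSpace ℝ (Fin D)) :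
    ∑ l, A (EuclideanSpace.single l 1) * c l = A c := by
  conv_rhs => rw [← (EuclideanSpace.basisFun (Fin D) ℝ).sum_repr c]
  simp [mul_comm]

theorem TwiceDifferentiableOn.mul {f g : EuclideanSpace ℝ (Fin D) → ℝ}
    (hf : TwiceDifferentiableOn f s) (hg : TwiceDifferentiableOn g s) :
    TwiceDifferentiableOn (fun x => f x * g x) s := by
  obtain ⟨f', hf', hf''⟩ := hf
  obtain ⟨g', hg', hg''⟩ := hg
  have hfd : DifferentiableOn ℝ f s := fun x hx => (hf' x hx).differentiableWithinAt
  have hgd : DifferentiableOn ℝ g s := fun x hx => (hg' x hx).differentiableWithinAt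
  exact ⟨fun x => f x • g' x + g x • f' x, fun x hx => (hf' x hx).fun_mul (hg' x hx),
    (hfd.fun_smul hg'').fun_add (hgd.fun_smul hf'')⟩

theorem TwiceDifferentiableOn.congr {f g : EuclideanSpace ℝ (Fin D) → ℝ}
    (hf : TwiceDifferentiableOn f s) (hfg : ∀ x ∈ s, g x = f x) : TwiceDifferentiableOn g s := by
  obtain ⟨f', hf', hf''⟩ := hf
  exact ⟨f', fun x hx => (hf' x hx).congr hfg (hfg x hx), hf''⟩

theorem TwiceDifferentiableOn.prod {ι : Type*} (t : Finset ι)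
    {f : ι → EuclideanSpace ℝ (Fin D) → ℝ} (hf : ∀ i ∈ t, TwiceDifferentiableOn (f i) s) :
    TwiceDifferentiableOn (fun x => ∏ i ∈ t, f i x) s := by
  classical
  induction t using Finset.induction_on with
  | empty =>
    simp only [Finset.prod_empty]
    exact ⟨0, fun x _ => hasFDerivWithinAt_const 1 x s, differentiableOn_const 0⟩
  | insert i t hi ih =>
    simp only [Finset.prod_insert hi]
    exact (hf i (Finset.mem_insert_self i t)).mul
      (ih fun j hj => hf j (Finset.mem_insert_of_mem hj))

/-- The logarithmic derivative is `∂ₘ p / p`, whose derivative in a direction `c` annihilated by the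
differential of `p` is `∂_c ∂ₘ p / p`. -/
theorem fderivWithin_partialDerivWithin_log {p : EuclideanSpace ℝ (Fin D) → ℝ}
    {p' : EuclideanSpace ℝ (Fin D) → EuclideanSpace ℝ (Fin D) →L[ℝ] ℝ}
    (hp : ∀ x ∈ s, HasFDerivWithinAt p (p' x) s x) (hp' : DifferentiableWithinAt ℝ p' s θ)
    (hθ : θ ∈ s) (hu : ∀ᶠ x in 𝓝[s] θ, UniqueDiffWithinAt ℝ s x) (h0 : p θ ≠ 0)
    {c : EuclideanSpace ℝ (Fin D)} (hc : p' θ c = 0) (m : Fin D) :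
    p θ * fderivWithin ℝ (partialDerivWithin s (fun x => Real.log (p x)) m) s θ c =
      fderivWithin ℝ p' s θ c (EuclideanSpace.single m 1) := by
  have huθ : UniqueDiffWithinAt ℝ s θ := hu.self_of_nhdsWithin hθ
  have hne : ∀ᶠ x in 𝓝[s] θ, p x ≠ 0 := (hp θ hθ).continuousWithinAt.eventually_ne h0
  have hev : partialDerivWithin s (fun x => Real.log (p x)) m =ᶠ[𝓝[s] θ]
      fun x => (p x)⁻¹ * p' x (EuclideanSpace.single m 1) := by
    filter_upwards [hu, hne, self_mem_nhdsWithin] with x hux hx hxs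
    rw [partialDerivWithin, ((hp x hxs).log hx).fderivWithin hux]
    rfl
  have hinv := (hasDerivAt_inv h0).comp_hasFDerivWithinAt θ (hp θ hθ)
  have happ := hp'.hasFDerivWithinAt.clm_apply
    (hasFDerivWithinAt_const (EuclideanSpace.single m (1 : ℝ)) θ s)
  have hmul := hinv.fun_mul happ
  rw [(hmul.congr_of_eventuallyEq hev (hev.self_of_nhdsWithin hθ)).fderivWithin huθ]
  simp [hc, h0]

/-- Minus the expected second derivatives of the log-likelihood of a finite statistical model form
a singular matrix if some nonzero direction is annihilated by the differentials of all the
probabilities: contracting with it turns the sum into a second derivative of the total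
probability. -/
theorem det_expected_hessian_log_eq_zero {W : Type*} [Fintype W]
    {p : W → EuclideanSpace ℝ (Fin D) → ℝ} (hp : ∀ w, TwiceDifferentiableOn (p w) s)
    (hsum : ∀ x ∈ s, ∑ w, p w x = 1) (hθ : θ ∈ s)
    (hu : ∀ᶠ x in 𝓝[s] θ, UniqueDiffWithinAt ℝ s x)
    (h0 : ∀ w, p w θ ≠ 0 ∨ ∀ᶠ x in 𝓝[s] θ, p w x = 0)
    {c : EuclideanSpace ℝ (Fin D)} (hc0 : c ≠ 0) (hc : ∀ w, fderivWithin ℝ (p w) s θ c = 0) :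
    (Matrix.of fun l m => -∑ w, p w θ * partialDerivWithin s
      (partialDerivWithin s (fun x => Real.log (p w x)) m) l θ).det = 0 := by
  choose p' hp' hp'' using hp
  have huθ : UniqueDiffWithinAt ℝ s θ := hu.self_of_nhdsWithin hθ
  have hterm : ∀ w m, p w θ *
      fderivWithin ℝ (partialDerivWithin s (fun x => Real.log (p w x)) m) s θ c =
      fderivWithin ℝ (p' w) s θ c (EuclideanSpace.single m 1) := by
    intro w m
    rcases h0 w with h | h
    · refine fderivWithin_partialDerivWithin_log (hp' w) (hp'' w θ hθ) hθ hu h ?_ m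
      rw [← (hp' w θ hθ).fderivWithin huθ, hc w]
    · have hev : p' w =ᶠ[𝓝[s] θ] fun _ => 0 := by
        filter_upwards [eventually_eventually_nhdsWithin.2 h, hu, self_mem_nhdsWithin]
          with x hx hux hxs
        exact hux.eq (hp' w x hxs) ((hasFDerivWithinAt_const (0 : ℝ) x s).congr_of_eventuallyEq
          hx (hx.self_of_nhdsWithin hxs))
      rw [h.self_of_nhdsWithin hθ, hev.fderivWithin_eq (hev.self_of_nhdsWithin hθ)]
      simp
  have htotal : ∑ w, fderivWithin ℝ (p' w) s θ = 0 := by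
    have hev : (fun x => ∑ w, p' w x) =ᶠ[𝓝[s] θ] fun _ => 0 := by
      filter_upwards [hu, self_mem_nhdsWithin] with x hux hxs
      exact hux.eq (HasFDerivWithinAt.fun_sum fun w _ => hp' w x hxs)
        ((hasFDerivWithinAt_const (1 : ℝ) x s).congr hsum (hsum x hxs))
    exact huθ.eq (HasFDerivWithinAt.fun_sum fun w _ => (hp'' w θ hθ).hasFDerivWithinAt)
      ((hasFDerivWithinAt_const _ θ s).congr_of_eventuallyEq hev (hev.self_of_nhdsWithin hθ))
  refine Matrix.exists_vecMul_eq_zero_iff.1 ⟨c.ofLp, ?_, ?_⟩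
  · simpa using hc0
  · ext m
    calc ∑ l, c l * -∑ w, p w θ * partialDerivWithin s
            (partialDerivWithin s (fun x => Real.log (p w x)) m) l θ
        = -∑ w, p w θ * ∑ l, partialDerivWithin s
            (partialDerivWithin s (fun x => Real.log (p w x)) m) l θ * c l := by
          simp_rw [mul_neg, Finset.sum_neg_distrib, Finset.mul_sum]
          rw [Finset.sum_comm]
          simp_rw [mul_left_comm, mul_comm]
      _ = -∑ w, fderivWithin ℝ (p' w) s θ c (EuclideanSpace.single m 1) := by
          refine congrArg _ (Finset.sum_congr rfl fun w _ => ?_)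
          rw [← hterm]
          exact congrArg _ (sum_apply_single_mul _ c)
      _ = 0 := by
          have h := congrArg (fun A => A c (EuclideanSpace.single m (1 : ℝ))) htotal
          simpa using h

end Calculus

/-! ### Outcome probabilities -/

namespace Superquantizer

variable {X : Type u} [MeasurableSpace X] (Γ : Superquantizer.{u, v} X)

theorem card_outcome : Fintype.card Γ.Outcome = Γ.numOutcomes := by
  simp [numOutcomes, Fintype.card_pi]

theorem numOutcomes_pos : 0 < Γ.numOutcomes := Finset.prod_pos fun l _ => Γ.R_pos l

/-- The outcome in which all the levels are the lowest. -/
def lowest : Γ.Outcome := fun l => ⟨0, Γ.R_pos l⟩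

theorem sum_measureReal_output_eq (μ : MeasureTheory.Measure X)
    [MeasureTheory.IsProbabilityMeasure μ] :
    ∑ s : Γ.Outcome, μ.real {x | Γ.output x = s} = 1 := by
  have hm : Measurable Γ.output := measurable_pi_lambda _ Γ.measurable_level
  have h := MeasureTheory.sum_measureReal_preimage_singleton (μ := μ) Finset.univ
    fun s _ => hm (measurableSet_singleton s)
  rw [Finset.coe_univ, Set.preimage_univ, MeasureTheory.probReal_univ] at h
  exact h

end Superquantizer

namespace SensorSystem

variable {D : ℕ} (S : SensorSystem.{u, v} D) {θ : EuclideanSpace ℝ (Fin D)}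

theorem prob_eq_prod (w : S.Data) (hθ : θ ∈ S.Θ) : S.prob w θ = ∏ j, S.q j (w j) θ := by
  have := fun j => S.law_prob j θ hθ
  have hset : {x : ∀ j, S.X j | ∀ j, (S.Γ j).output (x j) = w j} =
      Set.univ.pi fun j => {x | (S.Γ j).output x = w j} := by
    ext x
    simp
  rw [prob, hset, MeasureTheory.measureReal_def, MeasureTheory.Measure.pi_pi, ENNReal.toReal_prod]
  rfl

theorem sum_q (j : Fin S.N) (hθ : θ ∈ S.Θ) : ∑ s, S.q j s θ = 1 := by
  have := S.law_prob j θ hθ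
  exact (S.Γ j).sum_measureReal_output_eq (S.law j θ)

theorem sum_prob (hθ : θ ∈ S.Θ) : ∑ w, S.prob w θ = 1 := by
  simp_rw [fun w => S.prob_eq_prod w hθ]
  rw [← Fintype.prod_sum fun j s => S.q j s θ]
  simp [S.sum_q _ hθ]

/-- The Fisher information matrix annihilates every direction in which no outcome probability
changes. -/
theorem det_fisher_eq_zero {c : EuclideanSpace ℝ (Fin D)} (hc0 : c ≠ 0)
    (hc : ∀ j s, fderivWithin ℝ (S.q j s) S.Θ θ c = 0) : (S.fisher θ).det = 0 := by
  refine Matrix.exists_mulVec_eq_zero_iff.1 ⟨c.ofLp, by simpa using hc0, ?_⟩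
  rw [fisher, Matrix.sum_mulVec]
  refine Finset.sum_eq_zero fun j _ => ?_
  rw [Matrix.sum_mulVec]
  refine Finset.sum_eq_zero fun s _ => ?_
  have h : (fun l => partialDerivWithin S.Θ (S.q j s) l θ) ⬝ᵥ c.ofLp = 0 :=
    (sum_apply_single_mul _ c).trans (hc j s)
  rw [Matrix.smul_mulVec, Matrix.vecMulVec_mulVec, h]
  simp

/-- The outcome probabilities of the whole data are products over the sensors, so their
differentials vanish wherever those of the single sensors do. -/
theorem det_hessianFisher_eq_zero (hq : ∀ j s, TwiceDifferentiableOn (S.q j s) S.Θ)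
    (hθ : θ ∈ S.Θ) (hu : ∀ᶠ x in 𝓝[S.Θ] θ, UniqueDiffWithinAt ℝ S.Θ x)
    (h0 : ∀ j s, S.q j s θ ≠ 0 ∨ ∀ᶠ x in 𝓝[S.Θ] θ, S.q j s x = 0)
    {c : EuclideanSpace ℝ (Fin D)} (hc0 : c ≠ 0)
    (hc : ∀ j s, fderivWithin ℝ (S.q j s) S.Θ θ c = 0) : (S.hessianFisher θ).det = 0 := by
  have huθ : UniqueDiffWithinAt ℝ S.Θ θ := hu.self_of_nhdsWithin hθ
  have hprod : ∀ w, ∀ x ∈ S.Θ, S.prob w x = ∏ j, S.q j (w j) x := fun w x hx =>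
    S.prob_eq_prod w hx
  refine det_expected_hessian_log_eq_zero
    (fun w => (TwiceDifferentiableOn.prod _ fun j _ => hq j (w j)).congr (hprod w))
    (fun x hx => S.sum_prob hx) hθ hu (fun w => ?_) hc0 fun w => ?_
  · by_cases h : ∃ j, ∀ᶠ x in 𝓝[S.Θ] θ, S.q j (w j) x = 0
    · obtain ⟨j, hj⟩ := h
      right
      filter_upwards [hj, self_mem_nhdsWithin] with x hx hxs
      rw [hprod w x hxs, Finset.prod_eq_zero (Finset.mem_univ j) hx]
    · left
      rw [hprod w θ hθ]
      exact Finset.prod_ne_zero_iff.2 fun j _ => (h0 j (w j)).resolve_right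
        (not_exists.1 h j)
  · have hd : ∀ j, HasFDerivWithinAt (S.q j (w j)) (fderivWithin ℝ (S.q j (w j)) S.Θ θ) S.Θ θ := by
      intro j
      obtain ⟨q', hq', -⟩ := hq j (w j)
      exact (hq' θ hθ).differentiableWithinAt.hasFDerivWithinAt
    have h := (HasFDerivWithinAt.finsetProd (u := Finset.univ) fun j _ => hd j).congr (hprod w)
      (hprod w θ hθ)
    rw [h.fderivWithin huθ]
    simp [hc]

end SensorSystem

/-! ### Counting the free outcome probabilities -/

namespace GroupedSystem

variable {D : ℕ} (G : GroupedSystem.{u, v} D) {θ : EuclideanSpace ℝ (Fin D)}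

/-- The probability of the outcome `s` at any sensor of the subgroup `g`. -/
def cellProb (g : Σ p, Fin (G.M p)) (s : (G.Γ g.1 g.2).Outcome)
    (θ : EuclideanSpace ℝ (Fin D)) : ℝ :=
  (G.law g.1 θ).real {x | (G.Γ g.1 g.2).output x = s}

/-- Pairs of a subgroup and an outcome other than the lowest one; the probabilities of these
outcomes determine the rest. -/
abbrev FreeCell : Type :=
  Σ g : (Σ p, Fin (G.M p)), {s : (G.Γ g.1 g.2).Outcome // s ≠ (G.Γ g.1 g.2).lowest}

theorem card_freeCell : (Fintype.card G.FreeCell : ℤ) = G.rIDQD := by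
  have h : ∀ g : Σ p, Fin (G.M p),
      (Fintype.card {s : (G.Γ g.1 g.2).Outcome // s ≠ (G.Γ g.1 g.2).lowest} : ℤ) =
        ((G.Γ g.1 g.2).numOutcomes : ℤ) - 1 := by
    intro g
    rw [Fintype.card_subtype_compl, Fintype.card_subtype_eq, Superquantizer.card_outcome,
      Nat.cast_sub (G.Γ g.1 g.2).numOutcomes_pos, Nat.cast_one]
  rw [Fintype.card_sigma, Nat.cast_sum, Finset.sum_congr rfl fun g _ => h g, rIDQD,
    Fintype.sum_sigma]

theorem finrank_freeCell_lt (hD : (D : ℤ) > G.rIDQD) :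
    Module.finrank ℝ (G.FreeCell → ℝ) < Module.finrank ℝ (EuclideanSpace ℝ (Fin D)) := by
  rw [← G.card_freeCell] at hD
  rw [Module.finrank_fintype_fun_eq_card, finrank_euclideanSpace_fin]
  exact_mod_cast hD

/-- Every subgroup contains a sensor, and the surplus sensors contribute nonnegative terms. -/
theorem rIDQD_le_IDQD : G.rIDQD ≤ G.toSensorSystem.IDQD := by
  let f : (Σ p, Fin (G.M p)) → ℤ := fun g => ((G.Γ g.1 g.2).numOutcomes : ℤ) - 1
  have hf : ∀ g, 0 ≤ f g := fun g => by
    have := (G.Γ g.1 g.2).numOutcomes_pos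
    simp only [f]
    omega
  have h1 : G.toSensorSystem.IDQD = ∑ j, f (G.group j) := by
    simp only [f, Finset.sum_sub_distrib, Finset.sum_const, Finset.card_univ, Fintype.card_fin,
      nsmul_eq_mul, mul_one]
    rfl
  have h2 : G.rIDQD = ∑ g, f g := by rw [rIDQD, Fintype.sum_sigma]
  -- Pick one sensor from each subgroup.
  have hinj := Function.injective_surjInv G.group_surjective
  rw [h1, h2]
  calc ∑ g, f g = ∑ g, f (G.group (Function.surjInv G.group_surjective g)) := by
        simp [Function.surjInv_eq]
    _ = ∑ j ∈ Finset.univ.map ⟨_, hinj⟩, f (G.group j) := by simp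
    _ ≤ ∑ j, f (G.group j) :=
        Finset.sum_le_sum_of_subset_of_nonneg (Finset.subset_univ _) fun _ _ _ => hf _

/-- As every subgroup has a sensor, a property of all the functions `q` holds for all the functions
`cellProb`. -/
theorem forall_cellProb_of_forall_q (Q : (EuclideanSpace ℝ (Fin D) → ℝ) → Prop)
    (h : ∀ j s, Q (G.toSensorSystem.q j s)) (g : Σ p, Fin (G.M p))
    (s : (G.Γ g.1 g.2).Outcome) : Q (G.cellProb g s) := by
  obtain ⟨j, rfl⟩ := G.group_surjective g
  exact h j s

theorem sum_cellProb (g : Σ p, Fin (G.M p)) (hθ : θ ∈ G.Θ) : ∑ s, G.cellProb g s θ = 1 := by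
  have := G.law_prob g.1 θ hθ
  exact (G.Γ g.1 g.2).sum_measureReal_output_eq (G.law g.1 θ)

/-- With fewer free outcome probabilities than parameters, some direction leaves all the outcome
probabilities unchanged to first order. -/
theorem exists_ne_zero_fderivWithin_q_eq_zero (hD : (D : ℤ) > G.rIDQD)
    (hq : ∀ j s, DifferentiableWithinAt ℝ (G.toSensorSystem.q j s) G.Θ θ) (hθ : θ ∈ G.Θ)
    (hu : UniqueDiffWithinAt ℝ G.Θ θ) :
    ∃ c ≠ 0, ∀ j s, fderivWithin ℝ (G.toSensorSystem.q j s) G.Θ θ c = 0 := by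
  let A : EuclideanSpace ℝ (Fin D) →ₗ[ℝ] (G.FreeCell → ℝ) :=
    LinearMap.pi fun i => (fderivWithin ℝ (G.cellProb i.1 i.2.1) G.Θ θ).toLinearMap
  obtain ⟨c, hcA, hc0⟩ := (Submodule.ne_bot_iff _).1
    (LinearMap.ker_ne_bot_of_finrank_lt (f := A) (G.finrank_freeCell_lt hD))
  have hfree : ∀ g s, s ≠ (G.Γ g.1 g.2).lowest →
      fderivWithin ℝ (G.cellProb g s) G.Θ θ c = 0 := fun g s hs =>
    congrFun (LinearMap.mem_ker.1 hcA) ⟨g, s, hs⟩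
  have hd := G.forall_cellProb_of_forall_q (DifferentiableWithinAt ℝ · G.Θ θ) hq
  have hall : ∀ g s, fderivWithin ℝ (G.cellProb g s) G.Θ θ c = 0 := by
    intro g s
    by_cases hs : s = (G.Γ g.1 g.2).lowest
    · have htotal : ∑ s, fderivWithin ℝ (G.cellProb g s) G.Θ θ = 0 :=
        hu.eq (HasFDerivWithinAt.fun_sum fun s _ => (hd g s).hasFDerivWithinAt)
          ((hasFDerivWithinAt_const (1 : ℝ) θ G.Θ).congr (fun x hx => G.sum_cellProb g hx)
            (G.sum_cellProb g hθ))
      have h := congrArg (fun B => B c) htotal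
      simp only [sum_apply, zero_apply] at h
      rw [Finset.sum_eq_single s (fun t _ ht => hfree g t (hs ▸ ht))
        (fun h => absurd (Finset.mem_univ s) h)] at h
      exact h
    · exact hfree g s hs
  exact ⟨c, hc0, fun j s => hall (G.group j) s⟩

/-- The free outcome probabilities determine the law of the quantized data, and they form a
continuous map into a space of dimension less than `D`, which cannot be injective. -/
theorem exists_not_identifiableAt_of_isOpen (hD : (D : ℤ) > G.rIDQD)
    (hq : ∀ j s, ContinuousOn (G.toSensorSystem.q j s) G.Θ)
    {U : Set (EuclideanSpace ℝ (Fin D))} (hUΘ : U ⊆ G.Θ) (hU : IsOpen U) (hne : U.Nonempty) :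
    ∃ θ ∈ U, ¬ G.toSensorSystem.IdentifiableAt θ := by
  have hcont : ContinuousOn (fun θ (i : G.FreeCell) => G.cellProb i.1 i.2.1 θ) U :=
    continuousOn_pi.2 fun i =>
      (G.forall_cellProb_of_forall_q (ContinuousOn · G.Θ) hq i.1 i.2.1).mono hUΘ
  have hnot := not_injOn_of_finrank_lt (G.finrank_freeCell_lt hD) hU hne hcont
  simp only [Set.InjOn, not_forall] at hnot
  obtain ⟨θ, hθ, θ', hθ', heq, hneq⟩ := hnot
  refine ⟨θ, hθ, not_not.2 ⟨θ', hUΘ hθ, hUΘ hθ', hneq, fun w => ?_⟩⟩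
  have hfree : ∀ g s, s ≠ (G.Γ g.1 g.2).lowest → G.cellProb g s θ = G.cellProb g s θ' :=
    fun g s hs => congrFun heq ⟨g, s, hs⟩
  have hall : ∀ g s, G.cellProb g s θ = G.cellProb g s θ' := by
    intro g s
    by_cases hs : s = (G.Γ g.1 g.2).lowest
    · have h := (G.sum_cellProb g (hUΘ hθ)).trans (G.sum_cellProb g (hUΘ hθ')).symm
      rw [← Finset.add_sum_erase _ _ (Finset.mem_univ s),
        ← Finset.add_sum_erase _ (fun s => G.cellProb g s θ') (Finset.mem_univ s),
        Finset.sum_congr rfl fun t ht => hfree g t (hs ▸ Finset.ne_of_mem_erase ht)] at h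
      exact add_right_cancel h
    · exact hfree g s hs
  rw [G.toSensorSystem.prob_eq_prod w (hUΘ hθ), G.toSensorSystem.prob_eq_prod w (hUΘ hθ')]
  exact Finset.prod_congr rfl fun j _ => hall (G.group j) (w j)

theorem infinite_not_identifiableAt (hD : (D : ℤ) > G.rIDQD)
    (hq : ∀ j s, ContinuousOn (G.toSensorSystem.q j s) G.Θ)
    {U : Set (EuclideanSpace ℝ (Fin D))} (hUΘ : U ⊆ G.Θ) (hU : IsOpen U) (hne : U.Nonempty) :
    {θ | θ ∈ U ∧ ¬ G.toSensorSystem.IdentifiableAt θ}.Infinite := by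
  intro hfin
  -- Removing finitely many points leaves an open set, which again contains such a point.
  have : Nontrivial (EuclideanSpace ℝ (Fin D)) := by
    refine Module.nontrivial_of_finrank_pos (R := ℝ) ((Nat.zero_le _).trans_lt
      (G.finrank_freeCell_lt hD))
  obtain ⟨a, ha⟩ := hne
  have hUinf : U.Infinite := by
    have := Module.punctured_nhds_neBot ℝ (EuclideanSpace ℝ (Fin D)) a
    exact infinite_of_mem_nhds a (hU.mem_nhds ha)
  obtain ⟨θ, hθ, hid⟩ := G.exists_not_identifiableAt_of_isOpen hD hq
    (Set.sdiff_subset.trans hUΘ) (hU.sdiff hfin.isClosed) (hUinf.sdiff hfin).nonempty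
  exact hθ.2 ⟨hθ.1, hid⟩

end GroupedSystem

theorem theorem3 {D : ℕ} (G : GroupedSystem.{u, v} D) :
    G.rIDQD ≤ G.toSensorSystem.IDQD ∧
    ((interior G.Θ).Nonempty → (D : ℤ) > G.rIDQD →
      ((∀ j s, TwiceDifferentiableOn (G.toSensorSystem.q j s) G.Θ) →
        (∀ θ ∈ G.Θ, UniqueDiffWithinAt ℝ G.Θ θ → (G.toSensorSystem.fisher θ).det = 0) ∧
        (∀ θ ∈ G.Θ, (∀ᶠ x in 𝓝[G.Θ] θ, UniqueDiffWithinAt ℝ G.Θ x) →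
          (∀ j s, G.toSensorSystem.q j s θ ≠ 0 ∨
            ∀ᶠ x in 𝓝[G.Θ] θ, G.toSensorSystem.q j s x = 0) →
          (G.toSensorSystem.hessianFisher θ).det = 0)) ∧
      ((∀ j s, ContinuousOn (G.toSensorSystem.q j s) G.Θ) →
        ¬ G.toSensorSystem.IsIdentifiable ∧
        ∀ U : Set (EuclideanSpace ℝ (Fin D)), U ⊆ G.Θ → IsOpen U → U.Nonempty →
          {θ | θ ∈ U ∧ ¬ G.toSensorSystem.IdentifiableAt θ}.Infinite)) := by
  refine ⟨G.rIDQD_le_IDQD, fun hint hD => ⟨fun hq => ?_, fun hq => ⟨fun hid => ?_, ?_⟩⟩⟩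
  · have hdiff : ∀ θ ∈ G.Θ, ∀ j s,
        DifferentiableWithinAt ℝ (G.toSensorSystem.q j s) G.Θ θ := fun θ hθ j s => by
      obtain ⟨q', hq', -⟩ := hq j s
      exact (hq' θ hθ).differentiableWithinAt
    refine ⟨fun θ hθ hu => ?_, fun θ hθ hu h0 => ?_⟩
    · obtain ⟨c, hc0, hc⟩ := G.exists_ne_zero_fderivWithin_q_eq_zero hD (hdiff θ hθ) hθ hu
      exact G.toSensorSystem.det_fisher_eq_zero hc0 hc
    · obtain ⟨c, hc0, hc⟩ := G.exists_ne_zero_fderivWithin_q_eq_zero hD (hdiff θ hθ) hθ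
        (hu.self_of_nhdsWithin hθ)
      exact G.toSensorSystem.det_hessianFisher_eq_zero hq hθ hu h0 hc0 hc
  · obtain ⟨θ, hθ, hn⟩ := G.exists_not_identifiableAt_of_isOpen hD hq interior_subset isOpen_interior hint
    exact hn (hid θ (interior_subset hθ))
  · exact fun U hUΘ hU hne => G.infinite_not_identifiableAt hD hq hUΘ hU hne
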